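/- Let $\mathcal{D}$ be a small category in which every map factors as a split epimorphism followed by a monomorphism, and let $\widehat{\mathcal{D}}$ be the category of presheaves of sets on $\mathcal{D}$. A level of $\widehat{\mathcal{D}}$ is a string of adjoints $l_! \dashv l^* \dashv l_* : \mathcal{L} \to \widehat{\mathcal{D}}$ with $l_!$ and $l_*$ fully faithful. Levels are ordered as subtoposes: $l \le m$ if $l_*$ factors through $m_*$ up to isomorphism. A level $m$ is way-above $l$ if $l \le m$ and moreover $l_!$ factors through $m_*$ up to isomorphism. The Aufhebung of $l$ is, when it exists, the least level that is way-above $l$. Level $-\infty$ is the level whose domain is a terminal category, and level $0$ is the Aufhebung of level $-\infty$. Every full subcategory $\mathcal{C} \subseteq \mathcal{D}$ determines a level $\widehat{\mathcal{C}} \to \widehat{\mathcal{D}}$, given by restriction along the inclusion and its left and right Kan extensions. For a level $l$ and a presheaf $X$, let $\ell_X$ be the subobject of $X$ that is the image of the counit $l_!(l^*X) \to X$. A map $f : Y \to X$ in $\widehat{\mathcal{D}}$ is on top of a subobject $v$ of $X$ if, for every subobject $u$ of $X$, $f$ factors through $u \vee (u \Rightarrow v)$. The successor of a full subcategory $\mathcal{C}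 \subseteq \mathcal{D}$ is the full subcategory of those objects $D$ such that the identity of $\mathcal{D}(-,D)$ is on top of $\ell_{\mathcal{D}(-,D)}$, where $\ell$ comes from the level $\widehat{\mathcal{C}} \to \widehat{\mathcal{D}}$. Let $\mathcal{D}_0$ be the successor of the empty subcategory and let $\mathcal{D}_1$ be the successor of $\mathcal{D}_0$. Assume that $\mathcal{D}$ has a terminal object $1$ and that every object $D$ has a point $1 \to D$. Assume also that 1. every object of $\mathcal{D}_1$ with exactly one point is isomorphic to $1$; 2. every object $D$ of $\mathcal{D}$ is edge-wise connected: for all points $u, v : 1 \to D$ there are an object $E$ of $\mathcal{D}_1$ and a map $f : E \to D$ such that both $u$ and $v$ factor through $f$. Then level $0$ exists and is $\widehat{\mathcal{D}_0} \to \widehat{\mathcal{D}}$, and the Aufhebung of level $0$ exists and is $\widehat{\mathcal{D}_1} \to \widehat{\mathcal{D}}$, the successor of level $0$. -/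

import Mathlib

open CategoryTheory CategoryTheory.Limits

universe u v w

/-- A level of a category `E`: a string of adjoint functors `lower ⊣ inv ⊣ direct`
(usually written `l_! ⊣ l^* ⊣ l_* : L → E`) with fully faithful `lower` and `direct`.
The category `L` is taken in the universes of `E`; nothing is lost, because `L` is equivalent
to the full subcategory of `E` on the essential image of `direct`. -/
structure ToposLevel (E : Type v) [Category.{w} E] where
  /-- the domain of the level -/
  L : Type v
  [cat : Category.{w} L]
  /-- the skeletal inclusion `l_!` -/
  lower : L ⥤ E
  /-- the inverse image `l^*` -/
  inv : E ⥤ L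
  /-- the direct image `l_*` -/
  direct : L ⥤ E
  adjLower : lower ⊣ inv
  adjDirect : inv ⊣ direct
  full_lower : lower.Full
  faithful_lower : lower.Faithful
  full_direct : direct.Full
  faithful_direct : direct.Faithful

attribute [instance] ToposLevel.cat ToposLevel.full_lower ToposLevel.faithful_lower
  ToposLevel.full_direct ToposLevel.faithful_direct

namespace ToposLevel

variable {E : Type v} [Category.{w} E]

/-- The order of levels as subtoposes: `l_*` factors through `m_*` up to isomorphism. -/
def Below (l m : ToposLevel E) : Prop :=
  ∃ F : l.L ⥤ m.L, Nonempty (F ⋙ m.direct ≅ l.direct)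

/-- `m` is way-above `l`: `l ≤ m`, and `l_!` factors through `m_*` up to isomorphism. -/
def WayAbove (m l : ToposLevel E) : Prop :=
  l.Below m ∧ ∃ F : l.L ⥤ m.L, Nonempty (F ⋙ m.direct ≅ l.lower)

/-- `a` is the Aufhebung of `l`: the least level that is way-above `l`. -/
def IsAufhebung (a l : ToposLevel E) : Prop :=
  a.WayAbove l ∧ ∀ m : ToposLevel E, m.WayAbove l → a.Below m

/-- The degenerate level (level `-∞`): its domain is a terminal category. -/
def IsDegenerate (l : ToposLevel E) : Prop :=
  Nonempty (l.L ≌ Discrete PUnit.{1})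

/-- Level `0`: the Aufhebung of the degenerate level. -/
def IsLevelZero (l : ToposLevel E) : Prop :=
  ∃ b : ToposLevel E, b.IsDegenerate ∧ l.IsAufhebung b

end ToposLevel

section Presheaves

variable {D : Type u} [SmallCategory D]

/-- The level `Psh(C) → Psh(D)` determined by a full subcategory `C` of a small category `D`:
restriction along the inclusion, with its left and right Kan extensions. -/
noncomputable def presheafLevel (C : ObjectProperty D) : ToposLevel (Dᵒᵖ ⥤ Type u) where
  L := C.FullSubcategoryᵒᵖ ⥤ Type u
  lower := C.ι.op.lan
  inv := (Functor.whiskeringLeft _ _ (Type u)).obj C.ι.op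
  direct := C.ι.op.ran
  adjLower := C.ι.op.lanAdjunction (Type u)
  adjDirect := C.ι.op.ranAdjunction (Type u)
  full_lower := ((C.ι.op.lanAdjunction (Type u)).fullyFaithfulLOfIsIsoUnit).full
  faithful_lower := ((C.ι.op.lanAdjunction (Type u)).fullyFaithfulLOfIsIsoUnit).faithful
  full_direct := ((C.ι.op.ranAdjunction (Type u)).fullyFaithfulROfIsIsoCounit).full
  faithful_direct := ((C.ι.op.ranAdjunction (Type u)).fullyFaithfulROfIsIsoCounit).faithful

/-- The Heyting implication `U ⇒ V` of subpresheaves of `X`. -/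
def subpresheafImp {X : Dᵒᵖ ⥤ Type u} (U V : Subfunctor X) : Subfunctor X where
  obj A := {x | ∀ ⦃B : Dᵒᵖ⦄ (f : A ⟶ B), X.map f x ∈ U.obj B → X.map f x ∈ V.obj B}
  map {A A'} i x hx B f h := by
    have e : X.map f (X.map i x) = X.map (i ≫ f) x := by simp
    rw [e] at h ⊢
    exact hx (i ≫ f) h

/-- The universal property of the implication. -/
theorem le_subpresheafImp_iff {X : Dᵒᵖ ⥤ Type u} (U V W : Subfunctor X) :
    W ≤ subpresheafImp U V ↔ W ⊓ U ≤ V := by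
  constructor
  · intro h A x hx
    simpa using h A hx.1 (𝟙 A) (by simpa using hx.2)
  · intro h A x hx B f hf
    exact h B ⟨W.map f hx, hf⟩

/-- A map `f : Y ⟶ X` of presheaves is on top of the subobject `V` of `X` if it factors through
`U ∨ (U ⇒ V)` for every subobject `U` of `X`. -/
def OnTopOf {Y X : Dᵒᵖ ⥤ Type u} (f : Y ⟶ X) (V : Subfunctor X) : Prop :=
  ∀ U : Subfunctor X, Subfunctor.range f ≤ U ⊔ subpresheafImp U V

/-- The value at `X` of the principal comonad of a level `l`, with its monic counit: the image
of the skeleton `l_! (l^* X) ⟶ X`. -/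
def principalPart (l : ToposLevel (Dᵒᵖ ⥤ Type u)) (X : Dᵒᵖ ⥤ Type u) : Subfunctor X :=
  Subfunctor.range (l.adjLower.counit.app X)

/-- The successor of a full subcategory `C` of `D`: the full subcategory on the objects `A`
whose identity is (after Yoneda) on top of the counit of the principal comonad of the level
`Psh(C) → Psh(D)`. -/
def successor (C : ObjectProperty D) : ObjectProperty D := fun A =>
  OnTopOf (𝟙 (yoneda.obj A)) (principalPart (presheafLevel C) (yoneda.obj A))

variable (D) in
/-- `D₀`, the successor of the empty subcategory. -/
def levelZeroObjects : ObjectProperty D := successor (⊥ : ObjectProperty D)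

variable (D) in
/-- `D₁`, the successor of `D₀`; its objects are the edge types. -/
def edgeTypes : ObjectProperty D := successor (levelZeroObjects D)

/-- Every map factors as a split epimorphism followed by a monomorphism. -/
def HasSplitEpiMonoFactorizations (D : Type u) [SmallCategory D] : Prop :=
  ∀ ⦃X Y : D⦄ (f : X ⟶ Y), ∃ (B : D) (e : X ⟶ B) (m : B ⟶ Y),
    IsSplitEpi e ∧ Mono m ∧ e ≫ m = f

/-- `X` is edge-wise connected: any two points of `X` factor through one map from an edge type. -/
def EdgewiseConnected [HasTerminal D] (X : D) : Prop :=
  ∀ a b : ⊤_ D ⟶ X, ∃ A : D, edgeTypes D A ∧ ∃ f : A ⟶ X,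
    (∃ a' : ⊤_ D ⟶ A, a' ≫ f = a) ∧ (∃ b' : ⊤_ D ⟶ A, b' ≫ f = b)

end Presheaves

/-! A level is controlled by the maps its inverse image inverts: `direct` has the local objects as
its image, `lower` the colocal ones. So `l ≤ m` reverses inclusion of inverted classes, and `m` is
way-above `l` iff also every `l`-colocal object is `m`-local.

Since every object has a point, `D₀` consists of the terminal objects and its colocal presheaves are
the constant ones. Edge-wise connectedness makes constant presheaves local for `D₁`
(`isLocal_const`), so `D₁` is way-above level 0.

For minimality (`edgeTypes_below`), let `m` be way-above level 0 and `U` an `m`-dense sieve on an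
edge type `A`. If `U` is not maximal, it consists of constant maps. It contains all points of `A`,
and sending a constant map to its value extends from `U` to `A`, because constant presheaves are
`m`-local. This forces `A` to have a single point, so `A ≅ 1` and `U` is maximal after all. -/

namespace ToposLevel

variable {E : Type v} [Category.{w} E]

/-- `f` is sent to an isomorphism by the inverse image of the level. -/
def Inverts (l : ToposLevel E) {Y Z : E} (f : Y ⟶ Z) : Prop :=
  IsIso (l.inv.map f)

/-- `X` is orthogonal to the maps inverted by the level. -/
def IsLocal (l : ToposLevel E) (X : E) : Prop :=
  ∀ ⦃Y Z : E⦄ (f : Y ⟶ Z), l.Inverts f → Function.Bijective (fun g : Z ⟶ X => f ≫ g)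

/-- `X` is co-orthogonal to the maps inverted by the level. -/
def IsColocal (l : ToposLevel E) (X : E) : Prop :=
  ∀ ⦃Y Z : E⦄ (f : Y ⟶ Z), l.Inverts f → Function.Bijective (fun g : X ⟶ Y => g ≫ f)

/-! ### Levels in terms of local and colocal objects -/

variable {l m l' : ToposLevel E}

theorem bijective_precomp_direct_iff {Y Z : E} (f : Y ⟶ Z) (S : l.L) :
    Function.Bijective (fun g : Z ⟶ l.direct.obj S => f ≫ g) ↔
      Function.Bijective (fun g : l.inv.obj Z ⟶ S => l.inv.map f ≫ g) := by
  have h : (fun g : l.inv.obj Z ⟶ S => l.inv.map f ≫ g) =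
      (l.adjDirect.homEquiv Y S).symm ∘ (fun g : Z ⟶ l.direct.obj S => f ≫ g) ∘
        l.adjDirect.homEquiv Z S := by
    funext g
    simp [Adjunction.homEquiv_naturality_left_symm]
  rw [h]
  simp

theorem bijective_postcomp_lower_iff {Y Z : E} (f : Y ⟶ Z) (S : l.L) :
    Function.Bijective (fun g : l.lower.obj S ⟶ Y => g ≫ f) ↔
      Function.Bijective (fun g : S ⟶ l.inv.obj Y => g ≫ l.inv.map f) := by
  have h : (fun g : S ⟶ l.inv.obj Y => g ≫ l.inv.map f) =
      (l.adjLower.homEquiv S Z) ∘ (fun g : l.lower.obj S ⟶ Y => g ≫ f) ∘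
        (l.adjLower.homEquiv S Y).symm := by
    funext g
    simp [Adjunction.homEquiv_naturality_right]
  rw [h]
  simp

theorem isLocal_direct (l : ToposLevel E) (S : l.L) : l.IsLocal (l.direct.obj S) := by
  intro Y Z f hf
  rw [bijective_precomp_direct_iff]
  exact isIso_iff_coyoneda_map_bijective _ |>.1 hf S

theorem isColocal_lower (l : ToposLevel E) (S : l.L) : l.IsColocal (l.lower.obj S) := by
  intro Y Z f hf
  rw [bijective_postcomp_lower_iff]
  exact isIso_iff_yoneda_map_bijective _ |>.1 hf S

theorem IsLocal.of_iso {X X' : E} (h : l.IsLocal X) (e : X ≅ X') : l.IsLocal X' := by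
  intro Y Z f hf
  have e' : (fun g : Z ⟶ X' => f ≫ g) =
      (e.homToEquiv : (Y ⟶ X) ≃ (Y ⟶ X')) ∘ (fun g : Z ⟶ X => f ≫ g) ∘
        (e.homToEquiv : (Z ⟶ X) ≃ (Z ⟶ X')).symm := by
    funext g
    simp
  rw [e']
  simpa using h f hf

/-- Locality of `X` extends the identity along `f` to a retraction; uniqueness of extensions into
`Y` makes it two-sided. -/
theorem IsLocal.isIso {X Y : E} (hX : l.IsLocal X) (hY : l.IsLocal Y) (f : X ⟶ Y)
    (hf : l.Inverts f) : IsIso f := by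
  obtain ⟨g, hg⟩ := (hX f hf).2 (𝟙 X)
  refine ⟨g, hg, (hY f hf).1 ?_⟩
  simp only at hg
  simp [reassoc_of% hg]

theorem IsColocal.isIso {X Y : E} (hX : l.IsColocal X) (hY : l.IsColocal Y) (f : X ⟶ Y)
    (hf : l.Inverts f) : IsIso f := by
  obtain ⟨g, hg⟩ := (hY f hf).2 (𝟙 Y)
  refine ⟨g, (hX f hf).1 ?_, hg⟩
  simp only at hg
  simp [hg]

theorem inverts_unit (l : ToposLevel E) (X : E) : l.Inverts (l.adjDirect.unit.app X) := by
  have h := l.adjDirect.left_triangle_components X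
  have : IsIso (l.inv.map (l.adjDirect.unit.app X) ≫
      l.adjDirect.counit.app (l.inv.obj X)) := by
    rw [h]
    exact IsIso.id _
  exact IsIso.of_isIso_comp_right _ (l.adjDirect.counit.app (l.inv.obj X))

theorem inverts_counit (l : ToposLevel E) (X : E) : l.Inverts (l.adjLower.counit.app X) := by
  have h := l.adjLower.right_triangle_components X
  have : IsIso (l.adjLower.unit.app (l.inv.obj X) ≫
      l.inv.map (l.adjLower.counit.app X)) := by
    rw [h]
    exact IsIso.id _
  exact IsIso.of_isIso_comp_left (l.adjLower.unit.app (l.inv.obj X)) _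

theorem IsLocal.isIso_unit {X : E} (h : l.IsLocal X) : IsIso (l.adjDirect.unit.app X) :=
  h.isIso (l.isLocal_direct _) _ (l.inverts_unit X)

theorem IsColocal.isIso_counit {X : E} (h : l.IsColocal X) : IsIso (l.adjLower.counit.app X) :=
  (l.isColocal_lower _).isIso h _ (l.inverts_counit X)

/-- A functor factors through the direct image of a level iff its values are local. -/
theorem exists_comp_direct_iso_iff {J : Type*} [Category* J] (K : J ⥤ E) :
    (∃ F : J ⥤ m.L, Nonempty (F ⋙ m.direct ≅ K)) ↔ ∀ S, m.IsLocal (K.obj S) := by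
  constructor
  · rintro ⟨F, ⟨e⟩⟩ S
    exact (m.isLocal_direct (F.obj S)).of_iso (e.app S)
  · intro h
    have (S : J) : IsIso (m.adjDirect.unit.app (K.obj S)) := (h S).isIso_unit
    exact ⟨K ⋙ m.inv, ⟨(NatIso.ofComponents
      (fun S => asIso (m.adjDirect.unit.app (K.obj S)))
      (fun f => m.adjDirect.unit.naturality (K.map f))).symm⟩⟩

theorem below_iff :
    l.Below m ↔ ∀ ⦃Y Z : E⦄ (f : Y ⟶ Z), m.Inverts f → l.Inverts f := by
  rw [Below, exists_comp_direct_iso_iff]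
  constructor
  · intro h Y Z f hf
    rw [Inverts, isIso_iff_coyoneda_map_bijective]
    intro S
    exact (bijective_precomp_direct_iff f S).1 (h S f hf)
  · intro h S Y Z f hf
    exact l.isLocal_direct S f (h f hf)

theorem wayAbove_iff :
    m.WayAbove l ↔ l.Below m ∧ ∀ X : E, l.IsColocal X → m.IsLocal X := by
  rw [WayAbove, exists_comp_direct_iso_iff]
  refine and_congr_right fun _ => ⟨fun h X hX => ?_, fun h S => h _ (l.isColocal_lower S)⟩
  have := hX.isIso_counit
  exact (h _).of_iso (asIso (l.adjLower.counit.app X))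

theorem Below.trans {a b c : ToposLevel E} (h : a.Below b) (h' : b.Below c) : a.Below c := by
  rw [below_iff] at *
  exact fun Y Z f hf => h f (h' f hf)

theorem IsColocal.of_below {X : E} (hX : l.IsColocal X) (h : l.Below m) :
    m.IsColocal X :=
  fun _ _ f hf => hX f (below_iff.1 h f hf)

theorem WayAbove.of_below (h : m.WayAbove l) (h' : l'.Below l) : m.WayAbove l' := by
  rw [wayAbove_iff] at *
  exact ⟨h'.trans h.1, fun X hX => h.2 X (hX.of_below h')⟩

theorem IsAufhebung.congr (h : m.IsAufhebung l) (h₁ : l.Below l') (h₂ : l'.Below l) :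
    m.IsAufhebung l' :=
  ⟨h.1.of_below h₂, fun _ hk => h.2 _ (hk.of_below h₁)⟩

theorem IsDegenerate.inverts (h : l.IsDegenerate) {Y Z : E} (f : Y ⟶ Z) : l.Inverts f := by
  obtain ⟨e⟩ := h
  have : IsIso (e.functor.map (l.inv.map f)) := inferInstance
  exact isIso_of_reflects_iso (l.inv.map f) e.functor

theorem IsDegenerate.below (h : l.IsDegenerate) (m : ToposLevel E) : l.Below m :=
  below_iff.2 fun _ _ f _ => h.inverts f

/-- Any two levels that are level `0` have the same Aufhebungen. -/
theorem IsAufhebung.congr_isLevelZero (h : m.IsAufhebung l) (hl : l.IsLevelZero)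
    (hl' : l'.IsLevelZero) : m.IsAufhebung l' := by
  obtain ⟨b, hb, hlb⟩ := hl
  obtain ⟨b', hb', hlb'⟩ := hl'
  have h' := hlb'.congr (hb'.below b) (hb.below b')
  exact h.congr (hlb.2 _ h'.1) (h'.2 _ hlb.1)

end ToposLevel

/-! ### Presheaf levels and dense sieves -/

section Presheaves

open Opposite

variable {D : Type u} [SmallCategory D]

theorem presheafLevel_inverts_iff (C : ObjectProperty D) {Y Z : Dᵒᵖ ⥤ Type u} (f : Y ⟶ Z) :
    (presheafLevel C).Inverts f ↔ ∀ A, C A → Function.Bijective (f.app (op A)) := by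
  change IsIso (((Functor.whiskeringLeft _ _ (Type u)).obj C.ι.op).map f) ↔ _
  rw [NatTrans.isIso_iff_isIso_app]
  constructor
  · intro h A hA
    exact (isIso_iff_bijective _).1 (h (op ⟨A, hA⟩))
  · intro h A
    exact (isIso_iff_bijective _).2 (h A.unop.obj A.unop.property)

theorem presheafLevel_below_of_le {C C' : ObjectProperty D} (h : C ≤ C') :
    (presheafLevel C).Below (presheafLevel C') := by
  simp only [ToposLevel.below_iff, presheafLevel_inverts_iff]
  exact fun Y Z f hf A hA => hf A (h A hA)

theorem presheafLevel_bot_isDegenerate :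
    (presheafLevel (⊥ : ObjectProperty D)).IsDegenerate := by
  have : IsEmpty (⊥ : ObjectProperty D).FullSubcategoryᵒᵖ := ⟨fun A => A.unop.property⟩
  exact ⟨{
    functor := (Functor.const _).obj ⟨⟨⟩⟩
    inverse := (Functor.const _).obj ((Functor.const _).obj PUnit)
    unitIso := NatIso.ofComponents
      (fun F => NatIso.ofComponents (fun A => isEmptyElim A) (fun {A} => isEmptyElim A))
      (fun {F G} f => NatTrans.ext (funext fun (A : (⊥ : ObjectProperty D).FullSubcategoryᵒᵖ) =>
        isEmptyElim A))
    counitIso := NatIso.ofComponents (fun _ => Iso.refl _)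
    functor_unitIso_comp := fun F => Subsingleton.elim _ _ }⟩

/-- The skeleta for a degenerate level are empty. -/
theorem ToposLevel.IsDegenerate.isEmpty_of_isColocal {b : ToposLevel (Dᵒᵖ ⥤ Type u)}
    (hb : b.IsDegenerate) {X : Dᵒᵖ ⥤ Type u} (hX : b.IsColocal X) (A : Dᵒᵖ) :
    IsEmpty (X.obj A) := by
  let i : (Functor.const Dᵒᵖ).obj PEmpty.{u + 1} ⟶ X :=
    { app := fun A => ↾fun x => x.elim
      naturality := fun A B f => by ext x; exact x.elim }
  obtain ⟨g, -⟩ := (hX i (hb.inverts i)).2 (𝟙 X)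
  exact ⟨fun x => (g.app A x : PEmpty).elim⟩

/-- If the sieves on objects of `C` that are dense for `m` are maximal, then the level of `C`
is below `m`. -/
theorem presheafLevel_below_of_dense {C : ObjectProperty D} {m : ToposLevel (Dᵒᵖ ⥤ Type u)}
    (h : ∀ A, C A → ∀ U : Subfunctor (yoneda.obj A), m.Inverts U.ι → 𝟙 A ∈ U.obj (op A)) :
    (presheafLevel C).Below m := by
  have : PreservesLimitsOfSize.{0, 0} m.inv := m.adjLower.rightAdjoint_preservesLimits
  have surj : ∀ ⦃Y Z : Dᵒᵖ ⥤ Type u⦄ (f : Y ⟶ Z), m.Inverts f → ∀ A, C A →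
      Function.Surjective (f.app (op A)) := by
    intro Y Z f hf A hA z
    let g : yoneda.obj A ⟶ Z := yonedaEquiv.symm z
    -- The range of `q` is the sieve of maps along which `z` lifts through `f`. It is `m`-dense
    -- because `m.inv` preserves pullbacks.
    let q : pullback f g ⟶ yoneda.obj A := pullback.snd f g
    have hq : IsIso (m.inv.map q) := by
      have : IsIso (m.inv.map f) := hf
      exact ((IsPullback.of_hasPullback f g).map m.inv).isIso_snd_of_isIso
    have hU : m.Inverts (Subfunctor.range q).ι := by
      have e : m.inv.map (Subfunctor.toRange q) ≫ m.inv.map (Subfunctor.range q).ι =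
          m.inv.map q := by
        rw [← Functor.map_comp, Subfunctor.toRange_ι]
      have : IsSplitEpi (m.inv.map (Subfunctor.range q).ι) :=
        ⟨⟨⟨inv (m.inv.map q) ≫ m.inv.map (Subfunctor.toRange q), by simp [e]⟩⟩⟩
      exact isIso_of_mono_of_isSplitEpi _
    obtain ⟨w, hw⟩ := h A hA _ hU
    refine ⟨(pullback.fst f g).app (op A) w, ?_⟩
    have e := congr_arg (fun k => k.app (op A) w) (pullback.condition (f := f) (g := g))
    simp only [NatTrans.comp_app_apply] at e
    rw [e]
    change g.app (op A) (q.app (op A) w) = z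
    rw [hw]
    simp [g, yonedaEquiv_symm_app_apply]
  rw [ToposLevel.below_iff]
  intro Y Z f hf
  rw [presheafLevel_inverts_iff]
  refine fun A hA => ⟨fun y y' hy => ?_, surj f hf A hA⟩
  -- Injectivity of `f` is surjectivity of its diagonal, which is inverted as a section of an
  -- inverted projection.
  have hd : m.Inverts (pullback.diagonal f) := by
    have : IsIso (m.inv.map f) := hf
    have : IsIso (m.inv.map (pullback.fst f f)) :=
      ((IsPullback.of_hasPullback f f).map m.inv).isIso_fst_of_isIso
    have : IsIso (m.inv.map (pullback.diagonal f) ≫ m.inv.map (pullback.fst f f)) := by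
      rw [← Functor.map_comp, pullback.diagonal_fst]
      infer_instance
    exact IsIso.of_isIso_comp_right _ (m.inv.map (pullback.fst f f))
  let p : yoneda.obj A ⟶ pullback f f :=
    pullback.lift (yonedaEquiv.symm y) (yonedaEquiv.symm y') (by
      apply yonedaEquiv.injective
      simpa [yonedaEquiv_comp] using hy)
  have hp₁ : p ≫ pullback.fst f f = yonedaEquiv.symm y := pullback.lift_fst _ _ _
  have hp₂ : p ≫ pullback.snd f f = yonedaEquiv.symm y' := pullback.lift_snd _ _ _
  obtain ⟨x, hx⟩ := surj _ hd A hA (yonedaEquiv p)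
  have e₁ := congr_arg (fun k => k.app (op A) x) (pullback.diagonal_fst f)
  have e₂ := congr_arg (fun k => k.app (op A) x) (pullback.diagonal_snd f)
  simp only [NatTrans.comp_app_apply, hx, ← yonedaEquiv_comp] at e₁ e₂
  have e₁' : y = x := by simpa [hp₁] using e₁
  have e₂' : y' = x := by simpa [hp₂] using e₂
  rw [e₁', e₂']

/-- Over an object of the successor, a subobject is maximal or contained in the principal part. -/
theorem successor_iff {C : ObjectProperty D} {A : D} :
    successor C A ↔ ∀ U : Subfunctor (yoneda.obj A), 𝟙 A ∈ U.obj (op A) ∨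
      U ≤ principalPart (presheafLevel C) (yoneda.obj A) := by
  refine forall_congr' fun U => ?_
  constructor
  · intro h
    have h1 := h (op A) (show 𝟙 A ∈ (Subfunctor.range (𝟙 (yoneda.obj A))).obj (op A) from
      ⟨𝟙 A, rfl⟩)
    refine h1.imp_right fun h2 B x hx => ?_
    have e : (yoneda.obj A).map (Quiver.Hom.op (show B.unop ⟶ A from x)) (𝟙 A) = x :=
      Category.comp_id (show B.unop ⟶ A from x)
    have h3 := h2 (Quiver.Hom.op (show B.unop ⟶ A from x))
    rw [e] at h3
    exact h3 hx
  · rintro (h | h) B x -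
    · left
      have e : (yoneda.obj A).map (Quiver.Hom.op (show B.unop ⟶ A from x)) (𝟙 A) = x :=
        Category.comp_id (show B.unop ⟶ A from x)
      rw [← e]
      exact U.map _ h
    · right
      exact fun B' f hf => h B' hf

/-! ### Level 0: points and constant presheaves -/

variable [HasTerminal D]

/-- The identity of the terminal object belongs to every nonempty sieve. -/
theorem id_terminal_mem {A : D} (e : A ≅ ⊤_ D) (U : Subfunctor (yoneda.obj A)) {B : D}
    (p : ⊤_ D ⟶ B) (x : B ⟶ A) (hx : x ∈ U.obj (op B)) : 𝟙 A ∈ U.obj (op A) := by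
  have h : (yoneda.obj A).map (e.hom ≫ p).op x = 𝟙 A :=
    show (e.hom ≫ p) ≫ x = 𝟙 A by
      rw [← cancel_mono e.hom]
      exact Subsingleton.elim _ _
  rw [← h]
  exact U.map _ hx

theorem successor_of_iso_terminal (hpoint : ∀ X : D, Nonempty (⊤_ D ⟶ X)) (C : ObjectProperty D)
    {A : D} (e : A ≅ ⊤_ D) : successor C A := by
  rw [successor_iff]
  intro U
  by_cases h : ∃ (B : D) (x : B ⟶ A), x ∈ U.obj (op B)
  · obtain ⟨B, x, hx⟩ := h
    obtain ⟨p⟩ := hpoint B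
    exact Or.inl (id_terminal_mem e U p x hx)
  · exact Or.inr fun B x hx => (h ⟨B.unop, x, hx⟩).elim

/-- The sieve generated by a point is nonempty, so it cannot lie in the empty skeleton. Hence it is
maximal, and the point is an isomorphism. -/
theorem levelZeroObjects_iff (hpoint : ∀ X : D, Nonempty (⊤_ D ⟶ X)) (A : D) :
    levelZeroObjects D A ↔ Nonempty (A ≅ ⊤_ D) := by
  refine ⟨fun h => ?_, fun ⟨e⟩ => successor_of_iso_terminal hpoint _ e⟩
  obtain ⟨p⟩ := hpoint A
  rcases successor_iff.1 h (Subfunctor.range (yoneda.map p)) with h | h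
  · obtain ⟨x, hx⟩ := h
    exact ⟨⟨x, p, hx, Subsingleton.elim _ _⟩⟩
  · obtain ⟨y, -⟩ := h (op (⊤_ D)) ⟨𝟙 _, rfl⟩
    exact ((presheafLevel_bot_isDegenerate.isEmpty_of_isColocal
      (ToposLevel.isColocal_lower _ _) _).false y).elim

theorem levelZeroObjects_terminal (hpoint : ∀ X : D, Nonempty (⊤_ D ⟶ X)) :
    levelZeroObjects D (⊤_ D) :=
  successor_of_iso_terminal hpoint _ (Iso.refl _)

theorem levelZeroObjects_le_edgeTypes (hpoint : ∀ X : D, Nonempty (⊤_ D ⟶ X)) :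
    levelZeroObjects D ≤ edgeTypes D := fun A hA =>
  successor_of_iso_terminal hpoint _ ((levelZeroObjects_iff hpoint A).1 hA).some

/-- A map is inverted by the level of `D₀` iff it is bijective on points. -/
theorem levelZero_inverts_iff (hpoint : ∀ X : D, Nonempty (⊤_ D ⟶ X)) {Y Z : Dᵒᵖ ⥤ Type u}
    (f : Y ⟶ Z) : (presheafLevel (levelZeroObjects D)).Inverts f ↔
      Function.Bijective (f.app (op (⊤_ D))) := by
  rw [presheafLevel_inverts_iff]
  refine ⟨fun h => h _ (levelZeroObjects_terminal hpoint), fun h A hA => ?_⟩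
  obtain ⟨e⟩ := (levelZeroObjects_iff hpoint A).1 hA
  rw [← isIso_iff_bijective] at h ⊢
  exact (NatTrans.isIso_app_iff_of_iso f e.op).1 h

/-- The constant presheaf on the points of `X`, with its map to `X`. -/
noncomputable def constPoints (X : Dᵒᵖ ⥤ Type u) :
    (Functor.const Dᵒᵖ).obj (X.obj (op (⊤_ D))) ⟶ X where
  app B := X.map (terminal.from B.unop).op
  naturality B B' i := by
    rw [← X.map_comp]
    simp only [Functor.const_obj_obj, Functor.const_obj_map, Category.id_comp]
    congr 1
    exact Quiver.Hom.unop_inj (Subsingleton.elim _ _)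

theorem constPoints_inverts (hpoint : ∀ X : D, Nonempty (⊤_ D ⟶ X)) (X : Dᵒᵖ ⥤ Type u) :
    (presheafLevel (levelZeroObjects D)).Inverts (constPoints X) := by
  rw [levelZero_inverts_iff hpoint, ← isIso_iff_bijective]
  have : (terminal.from (⊤_ D)).op = 𝟙 (op (⊤_ D)) :=
    Quiver.Hom.unop_inj (Subsingleton.elim _ _)
  simp only [constPoints, this]
  infer_instance

/-- By naturality along `B ⟶ 1`, a map out of a constant presheaf amounts to a family of points of
the target. -/
theorem isColocal_const (hpoint : ∀ X : D, Nonempty (⊤_ D ⟶ X)) (T : Type u) :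
    (presheafLevel (levelZeroObjects D)).IsColocal ((Functor.const Dᵒᵖ).obj T) := by
  intro Y Z f hf
  rw [levelZero_inverts_iff hpoint] at hf
  have key : ∀ (W : Dᵒᵖ ⥤ Type u) (g : (Functor.const Dᵒᵖ).obj T ⟶ W) (B : Dᵒᵖ) (t : T),
      g.app B t = W.map (terminal.from B.unop).op (g.app (op (⊤_ D)) t) := fun W g B t =>
    NatTrans.naturality_apply g (terminal.from B.unop).op t
  constructor
  · intro g g' h
    ext B t
    exact (key _ g B t).trans ((congr_arg (Y.map (terminal.from B.unop).op)
      (hf.1 (congr_arg (fun k => k.app (op (⊤_ D)) t) h))).trans (key _ g' B t).symm)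
  · intro h
    choose s hs using hf.2
    refine ⟨(Functor.const Dᵒᵖ).map (↾fun t => s (h.app (op (⊤_ D)) t)) ≫ constPoints Y, ?_⟩
    ext B t
    refine Eq.trans ?_ (key _ h B t).symm
    change f.app B (Y.map (terminal.from B.unop).op (s (h.app (op (⊤_ D)) t))) = _
    rw [NatTrans.naturality_apply, hs]

theorem ToposLevel.IsColocal.isIso_constPoints (hpoint : ∀ X : D, Nonempty (⊤_ D ⟶ X))
    {X : Dᵒᵖ ⥤ Type u} (hX : (presheafLevel (levelZeroObjects D)).IsColocal X) :
    IsIso (constPoints X) :=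
  (isColocal_const hpoint _).isIso hX _ (constPoints_inverts hpoint X)

/-- The elements of the `0`-skeleton of a representable are the constant maps. -/
theorem exists_point_of_mem_principalPart (hpoint : ∀ X : D, Nonempty (⊤_ D ⟶ X)) {A B : D}
    (x : B ⟶ A)
    (hx : x ∈ (principalPart (presheafLevel (levelZeroObjects D)) (yoneda.obj A)).obj (op B)) :
    ∃ p : ⊤_ D ⟶ A, x = terminal.from B ≫ p := by
  let l := presheafLevel (levelZeroObjects D)
  let c := l.adjLower.counit.app (yoneda.obj A)
  obtain ⟨y, hy⟩ := hx
  have := (l.isColocal_lower (l.inv.obj (yoneda.obj A))).isIso_constPoints hpoint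
  have hb := (isIso_iff_bijective
    ((constPoints (l.lower.obj (l.inv.obj (yoneda.obj A)))).app (op B))).1 inferInstance
  obtain ⟨y', hy'⟩ := hb.2 y
  refine ⟨c.app (op (⊤_ D)) y', hy.symm.trans ((congr_arg (c.app (op B)) hy'.symm).trans ?_)⟩
  exact NatTrans.naturality_apply c (terminal.from B).op y'

theorem levelZero_wayAbove_degenerate (hpoint : ∀ X : D, Nonempty (⊤_ D ⟶ X))
    {b : ToposLevel (Dᵒᵖ ⥤ Type u)} (hb : b.IsDegenerate) :
    (presheafLevel (levelZeroObjects D)).WayAbove b := by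
  rw [ToposLevel.wayAbove_iff]
  refine ⟨hb.below _, fun X hX Y Z f hf => ?_⟩
  rw [levelZero_inverts_iff hpoint] at hf
  have hX' := hb.isEmpty_of_isColocal hX
  constructor
  · intro g g' _
    ext B z
    exact ((hX' B).false (g.app B z)).elim
  · intro g
    have hZ (B : Dᵒᵖ) (z : Z.obj B) : False := by
      obtain ⟨p⟩ := hpoint B.unop
      obtain ⟨y, -⟩ := hf.2 (Z.map p.op z)
      exact (hX' _).false (g.app _ y)
    refine ⟨{ app := fun B => ↾fun z => (hZ B z).elim
              naturality := fun B B' i => by ext z; exact (hZ B z).elim }, ?_⟩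
    ext B y
    exact ((hX' B).false (g.app B y)).elim

theorem levelZero_isAufhebung (hpoint : ∀ X : D, Nonempty (⊤_ D ⟶ X))
    {b : ToposLevel (Dᵒᵖ ⥤ Type u)} (hb : b.IsDegenerate) :
    (presheafLevel (levelZeroObjects D)).IsAufhebung b := by
  refine ⟨levelZero_wayAbove_degenerate hpoint hb, fun m hm => ?_⟩
  refine presheafLevel_below_of_dense fun A hA U hU => ?_
  obtain ⟨e⟩ := (levelZeroObjects_iff hpoint A).1 hA
  by_cases h : ∃ (B : D) (x : B ⟶ A), x ∈ U.obj (op B)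
  · obtain ⟨B, x, hx⟩ := h
    obtain ⟨p⟩ := hpoint B
    exact id_terminal_mem e U p x hx
  · have hU' (B : Dᵒᵖ) (x : U.toFunctor.obj B) : False := h ⟨B.unop, x.1, x.2⟩
    let X : Dᵒᵖ ⥤ Type u := (Functor.const Dᵒᵖ).obj PEmpty
    have hX : b.IsColocal X := by
      intro Y Z f _
      constructor
      · intro g g' _
        ext B x
        exact x.elim
      · intro g
        refine ⟨{ app := fun B => ↾fun x => x.elim
                  naturality := fun B B' i => by ext x; exact x.elim }, ?_⟩
        ext B x
        exact x.elim
    -- The empty presheaf is `m`-local, so an empty dense sieve would give a map from `yoneda.obj A`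
    -- to it.
    have hm' := (ToposLevel.wayAbove_iff.1 hm).2 X hX
    obtain ⟨g, -⟩ := (hm' U.ι hU).2
      { app := fun B => ↾fun x => (hU' B x).elim
        naturality := fun B B' i => by ext x; exact (hU' B x).elim }
    exact (g.app (op A) (𝟙 A) : PEmpty).elim

/-! ### The Aufhebung of level 0 -/

/-- If all objects are edge-wise connected, then discrete presheaves are local for `D₁`. -/
theorem isLocal_const (hpoint : ∀ X : D, Nonempty (⊤_ D ⟶ X))
    (hconn : ∀ X : D, EdgewiseConnected X) (T : Type u) :
    (presheafLevel (edgeTypes D)).IsLocal ((Functor.const Dᵒᵖ).obj T) := by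
  intro Y Z f hf
  rw [presheafLevel_inverts_iff] at hf
  have hf₁ := hf _ (levelZeroObjects_le_edgeTypes hpoint _ (levelZeroObjects_terminal hpoint))
  have key : ∀ (W : Dᵒᵖ ⥤ Type u) (g : W ⟶ (Functor.const Dᵒᵖ).obj T) {B B' : Dᵒᵖ} (i : B ⟶ B')
      (x : W.obj B), (g.app B' (W.map i x) : T) = g.app B x := fun W g B B' i x =>
    NatTrans.naturality_apply g i x
  constructor
  · intro g g' h
    ext B z
    obtain ⟨p⟩ := hpoint B.unop
    obtain ⟨y, hy⟩ := hf₁.2 (Z.map p.op z)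
    refine (key _ g p.op z).symm.trans (Eq.trans ?_ (key _ g' p.op z))
    rw [← hy]
    exact congr_arg (fun k => k.app (op (⊤_ D)) y) h
  · intro g
    choose s hs using hf₁.2
    have hs' (y : Y.obj (op (⊤_ D))) : s (f.app _ y) = y := hf₁.1 (hs _)
    -- The extension of `g` must take this value at `z`, for any point `p`; independence of `p` is
    -- what has to be shown.
    let φ (B : D) (z : Z.obj (op B)) (p : ⊤_ D ⟶ B) : T := g.app (op (⊤_ D)) (s (Z.map p.op z))
    have hφ (B : D) (z : Z.obj (op B)) (p q : ⊤_ D ⟶ B) : φ B z p = φ B z q := by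
      obtain ⟨A, hA, k, ⟨a, rfl⟩, ⟨b, rfl⟩⟩ := hconn B p q
      -- Restricted to an edge type, `z` lifts to `Y`, where `g` gives all points of the edge the
      -- same value.
      obtain ⟨y, hy⟩ := (hf A hA).2 (Z.map k.op z)
      have (c : ⊤_ D ⟶ A) : φ B z (c ≫ k) = g.app (op A) y := by
        simp only [φ, op_comp, Functor.map_comp, types_comp_apply]
        rw [← hy, ← NatTrans.naturality_apply, hs']
        exact key _ g c.op y
      rw [this, this]
    refine ⟨{ app := fun B => ↾fun z => φ B.unop z (hpoint B.unop).some
              naturality := fun B B' i => ?_ }, ?_⟩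
    · ext z
      change φ B'.unop (Z.map i z) _ = φ B.unop z _
      rw [hφ B.unop z _ ((hpoint B'.unop).some ≫ i.unop)]
      simp [φ]
    · ext B y
      change φ B.unop (f.app B y) _ = g.app B y
      simp only [φ]
      rw [← NatTrans.naturality_apply f, hs']
      exact key _ g _ y

theorem edgeTypes_wayAbove (hpoint : ∀ X : D, Nonempty (⊤_ D ⟶ X))
    (hconn : ∀ X : D, EdgewiseConnected X) :
    (presheafLevel (edgeTypes D)).WayAbove (presheafLevel (levelZeroObjects D)) := by
  rw [ToposLevel.wayAbove_iff]
  refine ⟨presheafLevel_below_of_le (levelZeroObjects_le_edgeTypes hpoint), fun X hX => ?_⟩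
  have := hX.isIso_constPoints hpoint
  exact (isLocal_const hpoint hconn _).of_iso (asIso (constPoints X))

theorem edgeTypes_below (hpoint : ∀ X : D, Nonempty (⊤_ D ⟶ X))
    (hone : ∀ A : D, edgeTypes D A → Nonempty (Unique (⊤_ D ⟶ A)) → Nonempty (A ≅ ⊤_ D))
    {m : ToposLevel (Dᵒᵖ ⥤ Type u)} (hm : m.WayAbove (presheafLevel (levelZeroObjects D))) :
    (presheafLevel (edgeTypes D)).Below m := by
  rw [ToposLevel.wayAbove_iff, ToposLevel.below_iff] at hm
  refine presheafLevel_below_of_dense fun A hA U hU => ?_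
  refine (successor_iff.1 hA U).elim id fun hle => ?_
  have hU₀ := hm.1 _ hU
  have hpt (p : ⊤_ D ⟶ A) : p ∈ U.obj (op (⊤_ D)) := by
    obtain ⟨y, hy⟩ := ((levelZero_inverts_iff hpoint _).1 hU₀).2 p
    rw [← hy]
    exact y.2
  have hconst {B : D} (x : B ⟶ A) (hx : x ∈ U.obj (op B)) (p q : ⊤_ D ⟶ B) : p ≫ x = q ≫ x := by
    obtain ⟨c, rfl⟩ := exists_point_of_mem_principalPart hpoint x (hle _ hx)
    simp only [← Category.assoc]
    congr 1
    exact Subsingleton.elim _ _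
  -- The value of a constant map, read off at any point of its domain.
  let g : U.toFunctor ⟶ (Functor.const Dᵒᵖ).obj (⊤_ D ⟶ A) :=
    { app := fun B => ↾fun x => (hpoint B.unop).some ≫ (show B.unop ⟶ A from x.1)
      naturality := fun B B' i => by
        ext x
        change (hpoint B'.unop).some ≫ i.unop ≫ (show B.unop ⟶ A from x.1) =
          (hpoint B.unop).some ≫ (show B.unop ⟶ A from x.1)
        rw [← Category.assoc]
        exact hconst _ x.2 _ _ }
  obtain ⟨h, hh⟩ := (hm.2 _ (isColocal_const hpoint _) U.ι hU).2 g
  -- The extension `h` fixes each point of `A`, yet naturality makes it agree at all of them with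
  -- its value at the identity.
  have huniq (p : ⊤_ D ⟶ A) : p = (h.app (op A) (𝟙 A) : ⊤_ D ⟶ A) := by
    have e₁ : (h.app (op (⊤_ D)) p : ⊤_ D ⟶ A) = p := by
      have := congr_arg (fun k => (k.app (op (⊤_ D)) ⟨p, hpt p⟩ : ⊤_ D ⟶ A)) hh
      refine Eq.trans this ?_
      change (hpoint (⊤_ D)).some ≫ p = p
      rw [Subsingleton.elim (hpoint (⊤_ D)).some (𝟙 _), Category.id_comp]
    have e₂ := NatTrans.naturality_apply h p.op (𝟙 A)
    have e₃ : (yoneda.obj A).map p.op (𝟙 A) = p := Category.comp_id p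
    rw [e₃] at e₂
    exact e₁.symm.trans e₂
  obtain ⟨p⟩ := hpoint A
  obtain ⟨e⟩ := hone A hA ⟨⟨⟨p⟩, fun q => (huniq q).trans (huniq p).symm⟩⟩
  exact id_terminal_mem e U (𝟙 _) p (hpt p)

end Presheaves

theorem mainTheorem11 {D : Type u} [SmallCategory D] [HasTerminal D]
    (hfact : HasSplitEpiMonoFactorizations D)
    (hpoint : ∀ X : D, Nonempty (⊤_ D ⟶ X))
    (hone : ∀ A : D, edgeTypes D A → Nonempty (Unique (⊤_ D ⟶ A)) → Nonempty (A ≅ ⊤_ D))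
    (hconn : ∀ X : D, EdgewiseConnected X) :
    (presheafLevel (levelZeroObjects D)).IsLevelZero ∧
      ∀ l : ToposLevel (Dᵒᵖ ⥤ Type u), l.IsLevelZero →
        (presheafLevel (edgeTypes D)).IsAufhebung l := by
  have h₀ : (presheafLevel (levelZeroObjects D)).IsLevelZero :=
    ⟨_, presheafLevel_bot_isDegenerate,
      levelZero_isAufhebung hpoint presheafLevel_bot_isDegenerate⟩
  have h₁ : (presheafLevel (edgeTypes D)).IsAufhebung (presheafLevel (levelZeroObjects D)) :=
    ⟨edgeTypes_wayAbove hpoint hconn, fun _ hm => edgeTypes_below hpoint hone hm⟩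
  exact ⟨h₀, fun l hl => h₁.congr_isLevelZero h₀ hl⟩
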